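/- Let $\mathcal K$ be a (locally small) category. A parallel pair $r_0,r_1\colon R\to A$ in $\mathcal K$ is a \emph{congruence} if it is collectively monic, reflexive ($r_0 d=\mathrm{id}_A=r_1 d$ for some $d\colon A\to R$), symmetric (the pair $r_1,r_0$ factorizes through $r_0,r_1$), and transitive (if the pairs $s,s'$ and $s',s''\colon S\to A$ factorize through $r_0,r_1$, then so does $s,s''$). For an object $G$ all of whose copowers $M\cdot G=\coprod_{M}G$ ($M$ a set) exist, we say that - $G$ is a \emph{strong generator} if for every object $X$ the canonical morphism $[f]\colon \coprod_{f\colon G\to X}G\to X$ is an extremal epimorphism (an epimorphism which does not factorize through any proper subobject of $X$); - $G$ is \emph{abstractly finite} if for every set $M$ each morphism $G\to M\cdot G$ factorizes through the canonical morphism $M_0\cdot G\to M\cdot G$ for some finite subset $M_0\subseteq M$; - $G$ is \emph{effective} if its hom-functor preserves coequalizers of congruences, that is, every congruence $r_0,r_1$ in $\mathcal K$ has a coequalizer, and $\mathcal K(G,-)\colon\mathcal K\to\mathbf{Set}$ preserves it. **Theorem.** A category $\mathcal K$ is equivalent to a variety of finitary one-sorted algebras (the category of all algebras of a finitary signature which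 satisfy a given set of equations, and their homomorphisms) if and only if 1. $\mathcal K$ has kernel pairs and coequalizers of kernel pairs, and 2. $\mathcal K$ has an effective, abstractly finite strong generator with copowers. -/

import Mathlib

open CategoryTheory CategoryTheory.Limits

universe v u

namespace VarietyChar

/-! ### Varieties of finitary one-sorted algebras -/

/-- A presentation of a variety: a (small) finitary one-sorted signature, i.e. a language without
relation symbols, and a set of equations between terms in countably many variables. -/
structure Variety where
  /-- The signature. -/
  sig : FirstOrder.Language.{v, 0}
  isAlgebraic : sig.IsAlgebraic
  /-- The equations. -/
  eqs : Set (sig.Term ℕ × sig.Term ℕ)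

/-- An algebra of the variety: an algebra of the signature (possibly empty) satisfying all the
equations. -/
structure Variety.Alg (V : Variety.{v}) where
  /-- The underlying set. -/
  carrier : Type v
  [str : V.sig.Structure carrier]
  sat : ∀ e ∈ V.eqs, ∀ x : ℕ → carrier, e.1.realize x = e.2.realize x

attribute [instance] Variety.Alg.str

/-- The category of algebras of a variety. The morphisms are the homomorphisms (there are no
relation symbols to be preserved). -/
instance Variety.Alg.category (V : Variety.{v}) : Category.{v} V.Alg where
  Hom A B := V.sig.Hom A.carrier B.carrier
  id A := FirstOrder.Language.Hom.id V.sig A.carrier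
  comp f g := FirstOrder.Language.Hom.comp g f

/-- A category is equivalent to a variety. -/
def IsEquivalentToVariety (C : Type u) [Category.{v} C] : Prop :=
  ∃ V : Variety.{v}, Nonempty (C ≌ V.Alg)

section

variable {C : Type u} [Category.{v} C]

/-! ### Kernel pairs and congruences -/

variable (C) in
/-- Every morphism has a kernel pair. -/
def HasKernelPairs : Prop :=
  ∀ ⦃X Y : C⦄ (f : X ⟶ Y), HasPullback f f

variable (C) in
/-- Every kernel pair has a coequalizer. -/
def HasCoequalizersOfKernelPairs : Prop :=
  ∀ ⦃R X Y : C⦄ (f : X ⟶ Y) (r₀ r₁ : R ⟶ X), IsKernelPair f r₀ r₁ → HasCoequalizer r₀ r₁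

/-- The pair `s₀, s₁` factorizes through the pair `r₀, r₁`. -/
def FactorsThroughPair {R A S : C} (r₀ r₁ : R ⟶ A) (s₀ s₁ : S ⟶ A) : Prop :=
  ∃ f : S ⟶ R, f ≫ r₀ = s₀ ∧ f ≫ r₁ = s₁

/-- A congruence on `A`: a collectively monic pair `r₀, r₁ : R ⟶ A` which is reflexive, symmetric
and transitive. No pullbacks are assumed to exist (as opposed to
`CategoryTheory.EquivalenceRelation`). -/
structure IsCongruence {R A : C} (r₀ r₁ : R ⟶ A) : Prop where
  collectively_monic : ∀ ⦃S : C⦄ (f g : S ⟶ R), f ≫ r₀ = g ≫ r₀ → f ≫ r₁ = g ≫ r₁ → f = g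
  refl : ∃ d : A ⟶ R, d ≫ r₀ = 𝟙 A ∧ d ≫ r₁ = 𝟙 A
  symm : FactorsThroughPair r₀ r₁ r₁ r₀
  trans : ∀ ⦃S : C⦄ (s s' s'' : S ⟶ A), FactorsThroughPair r₀ r₁ s s' →
    FactorsThroughPair r₀ r₁ s' s'' → FactorsThroughPair r₀ r₁ s s''

/-- `G` is effective: congruences have coequalizers, and the hom-functor of `G` preserves them. -/
def IsEffective (G : C) : Prop :=
  ∀ ⦃R A : C⦄ (r₀ r₁ : R ⟶ A), IsCongruence r₀ r₁ →
    HasCoequalizer r₀ r₁ ∧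
      PreservesColimit (parallelPair r₀ r₁) (coyoneda.obj (Opposite.op G))

/-! ### Copowers -/

/-- `G` has copowers, indexed by all sets. -/
class HasCopowers (G : C) : Prop where
  hasCoproduct : ∀ M : Type v, HasCoproduct (fun _ : M => G)

attribute [instance] HasCopowers.hasCoproduct

/-- The copower `M · G`. -/
noncomputable abbrev copower (M : Type v) (G : C) [HasCopowers G] : C :=
  ∐ fun _ : M => G

/-- The morphism `u · G : M · G ⟶ N · G` induced by a map `u : M → N`. -/
noncomputable def copowerMap {M N : Type v} (u : M → N) (G : C) [HasCopowers G] :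
    copower M G ⟶ copower N G :=
  Sigma.desc fun m => Sigma.ι (fun _ : N => G) (u m)

/-- The canonical morphism `[f] : C(G, X) · G ⟶ X`. -/
noncomputable def canonicalMorphism (G : C) [HasCopowers G] (X : C) : copower (G ⟶ X) G ⟶ X :=
  Sigma.desc fun f : G ⟶ X => f

/-- `G` is a strong generator: all the canonical morphisms are extremal epimorphisms. -/
def IsStrongGenerator (G : C) [HasCopowers G] : Prop :=
  ∀ X : C, ExtremalEpi (canonicalMorphism G X)

/-- `G` is abstractly finite: every morphism from `G` to a copower of `G` factorizes through
a finite subcopower. -/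
def IsAbstractlyFinite (G : C) [HasCopowers G] : Prop :=
  ∀ (M : Type v) (f : G ⟶ copower M G), ∃ M₀ : Set M, M₀.Finite ∧
    ∃ g : G ⟶ copower M₀ G, g ≫ copowerMap (Subtype.val : M₀ → M) G = f

end

end VarietyChar

/-! In a variety, the free algebra `G` on one generator represents the underlying set, so morphisms
out of `G` are elements. Effectivity then expresses quotients by congruences, abstract finiteness
the finiteness of terms, and strong generation the fact that surjective homomorphisms are extremal
epimorphisms.

Conversely, the morphisms `G ⟶ n·G` act as `n`-ary operations on every hom-set `G ⟶ X`, and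
`homVariety` imposes all equations valid in these hom-sets. By abstract finiteness the elements of
`G ⟶ M·G` are terms in the generators, so every algebra `A` is covered by the hom-algebra of `A·G`
(`exists_hom_of_copower`). Effectivity turns kernel pairs into image factorizations
(`exists_factorization`), and extremality of the canonical morphism then yields fullness.

Essential surjectivity must avoid products in `C`. Subalgebras of hom-algebras lie in the essential
image (`essImage_of_injective`), and `A` does as soon as the kernel pair of a cover does
(`essImage_of_kerPair`). If `A` maps to a hom-algebra, that kernel pair embeds in the hom-algebra of
a pullback (`essImage_of_hom`). For arbitrary `A`, the kernel pair itself maps to a hom-algebra, by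
projection. -/

namespace VarietyChar

open FirstOrder Language Structure

attribute [instance] Variety.isAlgebraic

/-! ### Algebras: kernel pairs, quotients and free algebras. -/

namespace Variety.Alg

variable {V : Variety.{v}} {A B D : V.Alg}

/-- The map underlying a morphism of algebras. -/
def app (f : A ⟶ B) : A.carrier → B.carrier :=
  FirstOrder.Language.Hom.toFun f

@[simp]
lemma app_id (x : A.carrier) : app (𝟙 A) x = x := rfl

@[simp]
lemma app_comp (f : A ⟶ B) (g : B ⟶ D) (x : A.carrier) : app (f ≫ g) x = app g (app f x) := rfl

lemma hom_ext {f g : A ⟶ B} (h : ∀ x, app f x = app g x) : f = g :=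
  FirstOrder.Language.Hom.ext h

lemma app_funMap (f : A ⟶ B) {n : ℕ} (s : V.sig.Functions n) (x : Fin n → A.carrier) :
    app f (funMap s x) = funMap s fun i => app f (x i) :=
  FirstOrder.Language.Hom.map_fun' f s x

lemma app_realize (f : A ⟶ B) {α : Type*} (t : V.sig.Term α) (x : α → A.carrier) :
    app f (t.realize x) = t.realize fun i => app f (x i) := by
  induction t with
  | var => rfl
  | func s ts ih => simp only [Term.realize_func, app_funMap, ih]

/-- A morphism of algebras from a map which commutes with the operations. -/
def homMk (h : A.carrier → B.carrier)
    (hh : ∀ {n : ℕ} (s : V.sig.Functions n) (x : Fin n → A.carrier),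
      h (funMap s x) = funMap s fun i => h (x i)) : A ⟶ B :=
  ({ toFun := h
     map_fun' := hh
     map_rel' := fun r => isEmptyElim r } : V.sig.Hom A.carrier B.carrier)

lemma exists_iso_of_bijective (f : A ⟶ B) (hf : Function.Bijective (app f)) :
    ∃ e : A ≅ B, e.hom = f := by
  obtain ⟨g, hgf, hfg⟩ := Function.bijective_iff_has_inverse.mp hf
  refine ⟨⟨f, homMk g fun s x => hf.1 ?_, hom_ext hgf, hom_ext hfg⟩, rfl⟩
  rw [app_funMap, hfg]
  exact congrArg _ (funext fun i => (hfg _).symm)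

lemma exists_desc_of_surjective (q : A ⟶ B) (hq : Function.Surjective (app q)) (f : A ⟶ D)
    (hf : ∀ a b, app q a = app q b → app f a = app f b) :
    ∃ g : B ⟶ D, q ≫ g = f := by
  choose s hs using hq
  refine ⟨homMk (fun b => app f (s b)) fun t x => ?_, hom_ext fun a => hf _ _ (hs _)⟩
  rw [← app_funMap]
  apply hf
  rw [hs, app_funMap]
  exact congrArg _ (funext fun i => (hs _).symm)

lemma exists_lift_of_injective (j : B ⟶ D) (hj : Function.Injective (app j)) (f : A ⟶ D)
    (hf : ∀ a, ∃ b, app j b = app f a) :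
    ∃ g : A ⟶ B, g ≫ j = f := by
  choose s hs using hf
  refine ⟨homMk s fun t x => hj ?_, hom_ext hs⟩
  rw [hs, app_funMap, app_funMap]
  exact congrArg _ (funext fun i => (hs _).symm)

/-- The kernel pair of a morphism of algebras. -/
def kerPair (f : A ⟶ B) : V.Alg where
  carrier := { x : A.carrier × A.carrier // app f x.1 = app f x.2 }
  str :=
    { funMap := fun s x => ⟨(funMap s fun i => (x i).1.1, funMap s fun i => (x i).1.2), by
        simp only [app_funMap, (x _).2]⟩
      RelMap := fun r => isEmptyElim r }
  sat e he x := by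
    let S : V.sig.Structure { x : A.carrier × A.carrier // app f x.1 = app f x.2 } :=
      { funMap := fun s x => ⟨(funMap s fun i => (x i).1.1, funMap s fun i => (x i).1.2), by
          simp only [app_funMap, (x _).2]⟩
        RelMap := fun r => isEmptyElim r }
    have key : ∀ t : V.sig.Term ℕ, (t.realize x).1 =
        (t.realize fun i => (x i).1.1, t.realize fun i => (x i).1.2) := by
      intro t
      induction t with
      | var => rfl
      | func s ts ih =>
        refine Prod.ext ?_ ?_
        · exact congrArg (funMap s) (funext fun i => congrArg Prod.fst (ih i))
        · exact congrArg (funMap s) (funext fun i => congrArg Prod.snd (ih i))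
    exact Subtype.ext (by rw [key, key, A.sat e he, A.sat e he])

/-- The first projection of the kernel pair. -/
def kerFst (f : A ⟶ B) : kerPair f ⟶ A :=
  homMk (fun x => x.1.1) fun _ _ => rfl

/-- The second projection of the kernel pair. -/
def kerSnd (f : A ⟶ B) : kerPair f ⟶ A :=
  homMk (fun x => x.1.2) fun _ _ => rfl

lemma kerPair_condition (f : A ⟶ B) (x : (kerPair f).carrier) :
    app f (app (kerFst f) x) = app f (app (kerSnd f) x) := x.2

lemma kerPair_ext (f : A ⟶ B) {x y : (kerPair f).carrier}
    (h₁ : app (kerFst f) x = app (kerFst f) y) (h₂ : app (kerSnd f) x = app (kerSnd f) y) :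
    x = y :=
  Subtype.ext (Prod.ext h₁ h₂)

lemma exists_kerPair (f : A ⟶ B) {a b : A.carrier} (h : app f a = app f b) :
    ∃ x, app (kerFst f) x = a ∧ app (kerSnd f) x = b :=
  ⟨⟨(a, b), h⟩, rfl, rfl⟩

lemma exists_kerPair_lift (f : A ⟶ B) (g h : D ⟶ A)
    (hgh : ∀ x, app f (app g x) = app f (app h x)) :
    ∃ k : D ⟶ kerPair f, k ≫ kerFst f = g ∧ k ≫ kerSnd f = h :=
  ⟨homMk (fun x => ⟨(app g x, app h x), hgh x⟩) fun s x =>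
    Subtype.ext (Prod.ext (app_funMap g s x) (app_funMap h s x)), rfl, rfl⟩

/-- The quotient of a structure by a congruence which contains all instances of the equations. -/
def ofQuotient {X : Type v} [V.sig.Structure X] (r : Setoid X)
    (hr : ∀ {n : ℕ} (s : V.sig.Functions n) (x y : Fin n → X),
      (∀ i, r (x i) (y i)) → r (funMap s x) (funMap s y))
    (hsat : ∀ e ∈ V.eqs, ∀ x : ℕ → X, r (e.1.realize x) (e.2.realize x)) : V.Alg :=
  letI : V.sig.Prestructure r :=
    { toStructure := inferInstance
      fun_equiv := fun {_ s} x y h => hr s x y h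
      rel_equiv := fun {_ r} => isEmptyElim r }
  { carrier := Quotient r
    sat := fun e he x => by
      obtain ⟨y, rfl⟩ : ∃ y : ℕ → X, (fun i => (⟦y i⟧ : Quotient r)) = x :=
        ⟨fun i => (x i).out, funext fun i => Quotient.out_eq _⟩
      rw [Term.realize_quotient_mk' r, Term.realize_quotient_mk' r]
      exact Quotient.sound (hsat e he y) }

section

variable {X : Type v} [V.sig.Structure X] (r : Setoid X)
    (hr : ∀ {n : ℕ} (s : V.sig.Functions n) (x y : Fin n → X),
      (∀ i, r (x i) (y i)) → r (funMap s x) (funMap s y))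
    (hsat : ∀ e ∈ V.eqs, ∀ x : ℕ → X, r (e.1.realize x) (e.2.realize x))

/-- The class of an element in the quotient structure. -/
def toQuotient (x : X) : (ofQuotient r hr hsat).carrier := Quotient.mk r x

lemma toQuotient_surjective : Function.Surjective (toQuotient r hr hsat) :=
  Quotient.mk_surjective

lemma toQuotient_eq_iff (x y : X) :
    toQuotient r hr hsat x = toQuotient r hr hsat y ↔ r x y :=
  Quotient.eq

lemma toQuotient_funMap {n : ℕ} (s : V.sig.Functions n) (x : Fin n → X) :
    toQuotient r hr hsat (funMap s x) = funMap s fun i => toQuotient r hr hsat (x i) :=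
  letI : V.sig.Prestructure r :=
    { toStructure := inferInstance
      fun_equiv := fun {_ s} x y h => hr s x y h
      rel_equiv := fun {_ r} => isEmptyElim r }
  (funMap_quotient_mk' r s x).symm

end

lemma exists_quotient (A : V.Alg) (r : Setoid A.carrier)
    (hr : ∀ {n : ℕ} (s : V.sig.Functions n) (x y : Fin n → A.carrier),
      (∀ i, r (x i) (y i)) → r (funMap s x) (funMap s y)) :
    ∃ (Q : V.Alg) (q : A ⟶ Q), Function.Surjective (app q) ∧
      ∀ x y, app q x = app q y ↔ r x y := by
  have hsat : ∀ e ∈ V.eqs, ∀ x : ℕ → A.carrier, r (e.1.realize x) (e.2.realize x) := by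
    intro e he x
    rw [A.sat e he x]
  exact ⟨ofQuotient r hr hsat, homMk (toQuotient r hr hsat) (toQuotient_funMap r hr hsat),
    toQuotient_surjective r hr hsat, toQuotient_eq_iff r hr hsat⟩

/-- The term algebra. -/
instance termStructure (M : Type v) : V.sig.Structure (V.sig.Term M) where
  funMap s ts := Term.func s ts
  RelMap r := isEmptyElim r

lemma realize_realize_term {M : Type v} {α : Type*} (t : V.sig.Term α) (σ : α → V.sig.Term M)
    (x : M → A.carrier) :
    (t.realize σ).realize x = t.realize fun i => (σ i).realize x := by
  induction t with
  | var => rfl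
  | func s ts ih => exact congrArg (funMap s) (funext ih)

variable (V) in
/-- Free algebras exist, and their elements are the values of terms in the generators. -/
lemma exists_free (M : Type v) : ∃ (P : V.Alg) (ι : M → P.carrier),
    (∀ (A : V.Alg) (x : M → A.carrier), ∃ f : P ⟶ A, ∀ m, app f (ι m) = x m) ∧
      ∀ p : P.carrier, ∃ t : V.sig.Term M, t.realize ι = p := by
  -- Semantic equality in all algebras of `V` replaces a deductive calculus, so evaluation is well
  -- defined on classes.
  let r : Setoid (V.sig.Term M) :=
    { r := fun s t => ∀ (A : V.Alg) (x : M → A.carrier), s.realize x = t.realize x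
      iseqv := ⟨fun _ _ _ => rfl, fun h A x => (h A x).symm,
        fun h h' A x => (h A x).trans (h' A x)⟩ }
  have hr : ∀ {n : ℕ} (s : V.sig.Functions n) (x y : Fin n → V.sig.Term M),
      (∀ i, r (x i) (y i)) → r (funMap s x) (funMap s y) := by
    intro n s x y h A z
    exact congrArg (funMap s) (funext fun i => h i A z)
  have hsat : ∀ e ∈ V.eqs, ∀ x : ℕ → V.sig.Term M, r (e.1.realize x) (e.2.realize x) := by
    intro e he x A z
    rw [realize_realize_term, realize_realize_term, A.sat e he]
  have hs := toQuotient_surjective r hr hsat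
  refine ⟨ofQuotient r hr hsat, fun m => toQuotient r hr hsat (Term.var m), fun A x => ?_,
    fun p => ?_⟩
  · choose s hs' using hs
    have key : ∀ t, (s (toQuotient r hr hsat t)).realize x = t.realize x := fun t =>
      (toQuotient_eq_iff r hr hsat _ _).mp (hs' _) A x
    refine ⟨homMk (fun p => (s p).realize x) fun f y => ?_, fun m => key _⟩
    obtain ⟨y, rfl⟩ : ∃ z, (fun i => toQuotient r hr hsat (z i)) = y :=
      ⟨fun i => s (y i), funext fun i => hs' _⟩
    rw [← toQuotient_funMap, key]
    simp only [key]
    rfl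
  · obtain ⟨t, rfl⟩ := hs p
    refine ⟨t, ?_⟩
    induction t with
    | var => rfl
    | func f ts ih =>
      refine Eq.trans ?_ (toQuotient_funMap r hr hsat f ts).symm
      exact congrArg (funMap f) (funext ih)

/-- Only finitely many variables occur in the two terms, so they can be renamed injectively into
`ℕ`. This brings identities in arbitrarily many variables within reach of `eqs`. -/
lemma exists_relabel_nat [hA : Nonempty A.carrier] {M : Type v} (t t' : V.sig.Term M) :
    ∃ φ : M → ℕ, ∀ x : M → A.carrier, ∃ y : ℕ → A.carrier,
      (t.relabel φ).realize y = t.realize x ∧ (t'.relabel φ).realize y = t'.realize x := by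
  classical
  let S : Set M := ↑(t.varFinset ∪ t'.varFinset)
  have hS : S.Countable := (Finset.countable_toSet _)
  obtain ⟨φ, hφ⟩ := Set.countable_iff_exists_injOn.mp hS
  refine ⟨φ, fun x => ?_⟩
  have aux : ∀ (y z : M → A.carrier) (s : V.sig.Term M), (∀ m ∈ s.varFinset, y m = z m) →
      s.realize y = s.realize z := by
    intro y z s h
    induction s with
    | var m => exact h m (by simp)
    | func f ts ih =>
      refine congrArg (funMap f) (funext fun i => ih i fun m hm => h m ?_)
      simp only [Term.varFinset, Finset.mem_biUnion, Finset.mem_univ, true_and]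
      exact ⟨i, hm⟩
  -- Naturals that name no occurring variable get an arbitrary value; this is where nonemptiness
  -- enters.
  let y : ℕ → A.carrier := fun n => if h : ∃ m ∈ S, φ m = n then x h.choose else hA.some
  have hy : ∀ m ∈ S, y (φ m) = x m := by
    intro m hm
    have h : ∃ m' ∈ S, φ m' = φ m := ⟨m, hm, rfl⟩
    simp only [y, dif_pos h]
    exact congrArg x (hφ h.choose_spec.1 hm h.choose_spec.2)
  refine ⟨y, ?_, ?_⟩
  · rw [Term.realize_relabel]
    exact aux _ _ t fun m hm => hy m (Finset.mem_coe.2 (Finset.mem_union_left _ hm))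
  · rw [Term.realize_relabel]
    exact aux _ _ t' fun m hm => hy m (Finset.mem_coe.2 (Finset.mem_union_right _ hm))

end Variety.Alg

end VarietyChar

namespace VarietyChar

/-! ### Coequalizers in sets and effectivity in terms of elements. -/

section Effective

variable {C : Type u} [Category.{v} C]

lemma nonempty_isColimit_types {X Y Z : Type v} {f g : X ⟶ Y} (h : Y ⟶ Z) (w : f ≫ h = g ≫ h)
    (hs : Function.Surjective h) (hk : ∀ y y', h y = h y' → ∃ x, f x = y ∧ g x = y') :
    Nonempty (IsColimit (Cofork.ofπ h w)) := by
  choose s hs using hs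
  refine ⟨Cofork.IsColimit.mk _ (fun c => ↾fun z => c.π (s z)) (fun c => ?_) fun c m hm => ?_⟩
  · ext y
    obtain ⟨x, hx, hx'⟩ := hk _ _ (hs (h y))
    change c.π (s (h y)) = c.π y
    rw [← hx, ← hx']
    exact ConcreteCategory.congr_hom c.condition x
  · ext z
    have := ConcreteCategory.congr_hom hm (s z)
    change m (h (s z)) = c.π (s z) at this
    rwa [hs] at this

lemma surjective_of_isColimit_types {X Y Z : Type v} {f g : X ⟶ Y} {h : Y ⟶ Z}
    {w : f ≫ h = g ≫ h} (hc : IsColimit (Cofork.ofπ h w)) : Function.Surjective h :=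
  (epi_iff_surjective h).mp (epi_of_isColimit_cofork hc)

/-- The quotient by the equivalence relation factors through the coequalizer `h`, so `h` identifies
no more than the relation does. -/
lemma exists_of_isColimit_types {X Y Z : Type v} {f g : X ⟶ Y} {h : Y ⟶ Z}
    {w : f ≫ h = g ≫ h} (hc : IsColimit (Cofork.ofπ h w))
    (he : _root_.Equivalence fun y y' => ∃ x, f x = y ∧ g x = y') {y y' : Y} (hy : h y = h y') :
    ∃ x, f x = y ∧ g x = y' := by
  let r : Setoid Y := ⟨_, he⟩
  let q : Y ⟶ Quotient r := ↾fun y => Quotient.mk r y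
  have hq : f ≫ q = g ≫ q := by
    ext x
    exact Quotient.sound ⟨x, rfl, rfl⟩
  have hd : h ≫ Cofork.IsColimit.desc hc q hq = q := Cofork.IsColimit.π_desc' hc q hq
  have e : ∀ z, (Cofork.IsColimit.desc hc q hq) (h z) = Quotient.mk r z :=
    ConcreteCategory.congr_hom hd
  exact Quotient.exact ((e y).symm.trans ((congrArg _ hy).trans (e y')))

lemma IsCongruence.equivalence {R A : C} {r₀ r₁ : R ⟶ A} (h : IsCongruence r₀ r₁) (S : C) :
    _root_.Equivalence fun s s' : S ⟶ A => FactorsThroughPair r₀ r₁ s s' where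
  refl s := by
    obtain ⟨d, h₀, h₁⟩ := h.refl
    exact ⟨s ≫ d, by simp [h₀], by simp [h₁]⟩
  symm := by
    rintro s s' ⟨f, rfl, rfl⟩
    obtain ⟨t, h₀, h₁⟩ := h.symm
    exact ⟨f ≫ t, by simp [h₀], by simp [h₁]⟩
  trans := h.trans _ _ _

lemma isCongruence_of_isKernelPair {R X Y : C} {f : X ⟶ Y} {r₀ r₁ : R ⟶ X}
    (h : IsKernelPair f r₀ r₁) : IsCongruence r₀ r₁ where
  collectively_monic _ _ _ h₀ h₁ := h.hom_ext h₀ h₁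
  refl := ⟨h.lift (𝟙 X) (𝟙 X) rfl, h.lift_fst _ _ _, h.lift_snd _ _ _⟩
  symm := ⟨h.lift r₁ r₀ h.w.symm, h.lift_fst _ _ _, h.lift_snd _ _ _⟩
  trans := by
    rintro S _ _ _ ⟨a, rfl, rfl⟩ ⟨b, hb, rfl⟩
    have : (a ≫ r₀) ≫ f = (b ≫ r₁) ≫ f := by
      rw [Category.assoc, h.w, ← Category.assoc, ← hb, Category.assoc, h.w, Category.assoc]
    exact ⟨h.lift _ _ this, h.lift_fst _ _ _, h.lift_snd _ _ _⟩

/-- A coequalizer of an equivalence relation in sets is a surjection whose kernel is that relation;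
here this is read on morphisms out of `G`. -/
lemma isEffective_iff (G : C) : IsEffective G ↔
    ∀ ⦃R A : C⦄ (r₀ r₁ : R ⟶ A), IsCongruence r₀ r₁ →
      ∃ (Q : C) (q : A ⟶ Q) (w : r₀ ≫ q = r₁ ≫ q), Nonempty (IsColimit (Cofork.ofπ q w)) ∧
        (∀ u : G ⟶ Q, ∃ v, v ≫ q = u) ∧
        ∀ s s' : G ⟶ A, s ≫ q = s' ≫ q → FactorsThroughPair r₀ r₁ s s' := by
  constructor
  · intro h R A r₀ r₁ hr
    obtain ⟨_, _⟩ := h r₀ r₁ hr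
    have hc := isColimitOfHasCoequalizerOfPreservesColimit
      (coyoneda.obj (Opposite.op G)) r₀ r₁
    exact ⟨_, coequalizer.π r₀ r₁, coequalizer.condition r₀ r₁,
      ⟨coequalizerIsCoequalizer r₀ r₁⟩, surjective_of_isColimit_types hc,
      fun s s' hs => exists_of_isColimit_types hc (hr.equivalence G) hs⟩
  · intro h R A r₀ r₁ hr
    obtain ⟨Q, q, w, ⟨hc⟩, hs, hk⟩ := h r₀ r₁ hr
    refine ⟨⟨⟨_, hc⟩⟩, preservesColimit_of_preserves_colimit_cocone hc ?_⟩
    refine (isColimitMapCoconeCoforkEquiv _ w).symm (Nonempty.some ?_)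
    exact nonempty_isColimit_types _ _ hs hk

end Effective

end VarietyChar

namespace VarietyChar

open FirstOrder Language Structure Variety.Alg

/-! ### From a variety to the generator. -/

section OfVariety

variable {C : Type u} [Category.{v} C] {V : Variety.{v}} (F : C ⥤ V.Alg)

/-- An element `g` of `F.obj G` which represents the underlying set functor. -/
def IsUniversalElement {G : C} (g : (F.obj G).carrier) : Prop :=
  ∀ (X : C) (x : (F.obj X).carrier), ∃! f : G ⟶ X, app (F.map f) g = x

lemma exists_free_object [F.IsEquivalence] (M : Type v) :
    ∃ (P : C) (ι : M → (F.obj P).carrier),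
      (∀ (X : C) (x : M → (F.obj X).carrier), ∃! f : P ⟶ X, ∀ m, app (F.map f) (ι m) = x m) ∧
        ∀ p : (F.obj P).carrier, ∃ t : V.sig.Term M, t.realize ι = p := by
  obtain ⟨P, ι, hP, ht⟩ := Variety.Alg.exists_free V M
  let i := F.objObjPreimageIso P
  have hi : ∀ x, app i.hom (app i.inv x) = x := fun x => by rw [← app_comp]; simp
  have hi' : ∀ x, app i.inv (app i.hom x) = x := fun x => by rw [← app_comp]; simp
  have ht' : ∀ p, ∃ t : V.sig.Term M, (t.realize fun m => app i.inv (ι m)) = p := by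
    intro p
    obtain ⟨t, h⟩ := ht (app i.hom p)
    exact ⟨t, by rw [← app_realize, h, hi']⟩
  refine ⟨F.objPreimage P, fun m => app i.inv (ι m), fun X x => ?_, ht'⟩
  obtain ⟨f, hf⟩ := hP _ x
  refine ⟨F.preimage (i.hom ≫ f), fun m => by simp [hi, hf], fun f' hf' => ?_⟩
  refine F.map_injective (hom_ext fun p => ?_)
  obtain ⟨t, rfl⟩ := ht' p
  rw [app_realize, app_realize]
  refine congrArg t.realize (funext fun m => ?_)
  rw [hf']
  simp [hi, hf]

lemma exists_isUniversalElement [F.IsEquivalence] :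
    ∃ (G : C) (g : (F.obj G).carrier), IsUniversalElement F g := by
  obtain ⟨G, ι, hG, -⟩ := exists_free_object F PUnit
  refine ⟨G, ι ⟨⟩, fun X x => ?_⟩
  obtain ⟨f, hf, hf'⟩ := hG X fun _ => x
  exact ⟨f, hf ⟨⟩, fun f' h => hf' f' fun _ => h⟩

lemma hasKernelPairs_of_isEquivalence [F.IsEquivalence] : HasKernelPairs C := by
  intro X Y f
  let i := F.objObjPreimageIso (kerPair (F.map f))
  let r₀ := F.preimage (i.hom ≫ kerFst (F.map f))
  let r₁ := F.preimage (i.hom ≫ kerSnd (F.map f))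
  have w : r₀ ≫ f = r₁ ≫ f := by
    refine F.map_injective (hom_ext fun x => ?_)
    simp [r₀, r₁, kerPair_condition]
  have h : ∀ s : PullbackCone f f, ∃ k : s.pt ⟶ F.objPreimage (kerPair (F.map f)),
      k ≫ r₀ = s.fst ∧ k ≫ r₁ = s.snd := by
    intro s
    obtain ⟨k, hk₀, hk₁⟩ := exists_kerPair_lift (F.map f) (F.map s.fst) (F.map s.snd) fun x => by
      rw [← app_comp, ← app_comp, ← F.map_comp, s.condition, F.map_comp]
    refine ⟨F.preimage (k ≫ i.inv), F.map_injective ?_, F.map_injective ?_⟩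
    · simp [r₀, hk₀]
    · simp [r₁, hk₁]
  choose k hk₀ hk₁ using h
  refine ⟨⟨_, PullbackCone.IsLimit.mk w k hk₀ hk₁ fun s m h₀ h₁ => F.map_injective ?_⟩⟩
  rw [← cancel_mono i.hom]
  refine hom_ext fun x => kerPair_ext _ ?_ ?_
  · have := (congrArg F.map (h₀.trans (hk₀ s).symm))
    simp only [r₀, F.map_comp, F.map_preimage] at this
    simpa using congrArg (fun a => app a x) this
  · have := (congrArg F.map (h₁.trans (hk₁ s).symm))
    simp only [r₁, F.map_comp, F.map_preimage] at this
    simpa using congrArg (fun a => app a x) this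

variable {F} {G : C} {g : (F.obj G).carrier}

lemma IsUniversalElement.hom_ext (hg : IsUniversalElement F g) {X : C} {f f' : G ⟶ X}
    (h : app (F.map f) g = app (F.map f') g) : f = f' :=
  (hg X _).unique rfl h.symm

lemma IsUniversalElement.exists_hom (hg : IsUniversalElement F g) {X : C}
    (x : (F.obj X).carrier) : ∃ f : G ⟶ X, app (F.map f) g = x :=
  (hg X x).exists

/-- Testing a congruence on morphisms out of `G` gives an equivalence relation on the underlying
set; the quotient algebra by it is the coequalizer. -/
lemma IsUniversalElement.isEffective [F.IsEquivalence] (hg : IsUniversalElement F g) :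
    IsEffective G := by
  rw [isEffective_iff]
  intro R A r₀ r₁ hr
  have hequiv := hr.equivalence G
  have hrel : ∀ s s' : G ⟶ A, FactorsThroughPair r₀ r₁ s s' ↔
      ∃ x, app (F.map r₀) x = app (F.map s) g ∧ app (F.map r₁) x = app (F.map s') g := by
    intro s s'
    constructor
    · rintro ⟨f, rfl, rfl⟩
      exact ⟨app (F.map f) g, by simp, by simp⟩
    · rintro ⟨x, h₀, h₁⟩
      obtain ⟨f, rfl⟩ := hg.exists_hom x
      exact ⟨f, hg.hom_ext (by simpa using h₀), hg.hom_ext (by simpa using h₁)⟩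
  let r : Setoid (F.obj A).carrier :=
    { r := fun a b => ∃ x, app (F.map r₀) x = a ∧ app (F.map r₁) x = b
      iseqv := by
        refine ⟨fun a => ?_, fun {a b} h => ?_, fun {a b c} h h' => ?_⟩
        · obtain ⟨s, rfl⟩ := hg.exists_hom a
          exact (hrel _ _).mp (hequiv.refl s)
        · obtain ⟨s, rfl⟩ := hg.exists_hom a
          obtain ⟨t, rfl⟩ := hg.exists_hom b
          exact (hrel _ _).mp (hequiv.symm ((hrel _ _).mpr h))
        · obtain ⟨s, rfl⟩ := hg.exists_hom a
          obtain ⟨t, rfl⟩ := hg.exists_hom b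
          obtain ⟨t', rfl⟩ := hg.exists_hom c
          exact (hrel _ _).mp (hequiv.trans ((hrel _ _).mpr h) ((hrel _ _).mpr h')) }
  obtain ⟨Q, q, hqs, hqr⟩ := exists_quotient (F.obj A) r (by
    intro n s x y h
    -- Both legs are homomorphisms, so operations applied to witnesses in `R` give witnesses again.
    choose z h₀ h₁ using h
    exact ⟨funMap s z, by simp only [app_funMap, h₀], by simp only [app_funMap, h₁]⟩)
  let i := F.objObjPreimageIso Q
  let q' : A ⟶ F.objPreimage Q := F.preimage (q ≫ i.inv)
  have hq' : F.map q' = q ≫ i.inv := F.map_preimage _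
  have hi : Function.LeftInverse (app i.inv) (app i.hom) :=
    fun x => by rw [← app_comp]; simp
  have hi' : Function.LeftInverse (app i.hom) (app i.inv) :=
    fun x => by rw [← app_comp]; simp
  have hqs' : Function.Surjective (app (F.map q')) := by
    rw [hq']
    exact hi.surjective.comp hqs
  have hqr' : ∀ x y, app (F.map q') x = app (F.map q') y ↔ r x y := by
    intro x y
    rw [hq', app_comp, app_comp, hi'.injective.eq_iff, hqr]
  have w : r₀ ≫ q' = r₁ ≫ q' := by
    refine F.map_injective (Variety.Alg.hom_ext fun x => ?_)
    rw [F.map_comp, F.map_comp]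
    exact (hqr' _ _).mpr ⟨x, rfl, rfl⟩
  refine ⟨_, q', w, ?_, fun u => ?_, fun s s' h => ?_⟩
  · have hd : ∀ c : Cofork r₀ r₁, ∃ d : F.objPreimage Q ⟶ c.pt, q' ≫ d = c.π := by
      intro c
      obtain ⟨d, hd⟩ := exists_desc_of_surjective _ hqs' (F.map c.π) fun a b hab => by
        obtain ⟨x, rfl, rfl⟩ := (hqr' _ _).mp hab
        rw [← app_comp, ← app_comp, ← F.map_comp, ← F.map_comp, c.condition]
      exact ⟨F.preimage d, F.map_injective (by simpa using hd)⟩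
    choose d hd using hd
    refine ⟨Cofork.IsColimit.mk _ d hd fun c m hm => F.map_injective ?_⟩
    refine Variety.Alg.hom_ext fun x => ?_
    obtain ⟨x, rfl⟩ := hqs' x
    rw [← app_comp, ← app_comp, ← F.map_comp, ← F.map_comp]
    exact congrArg (fun k => app (F.map k) x) (hm.trans (hd c).symm)
  · obtain ⟨x, hx⟩ := hqs' (app (F.map u) g)
    obtain ⟨v, rfl⟩ := hg.exists_hom x
    exact ⟨v, hg.hom_ext (by simpa using hx)⟩
  · refine (hrel _ _).mpr ((hqr' _ _).mp ?_)
    simpa using congrArg (fun k => app (F.map k) g) h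

lemma IsUniversalElement.hasCopowers [F.IsEquivalence] (hg : IsUniversalElement F g) :
    HasCopowers G where
  hasCoproduct M := by
    obtain ⟨P, ι, hP, -⟩ := exists_free_object F M
    choose i hi using fun m => hg.exists_hom (ι m)
    choose d hd hd' using fun (X : C) (x : M → (G ⟶ X)) => hP X fun m => app (F.map (x m)) g
    refine ⟨⟨_, Cofan.IsColimit.mk (Cofan.mk P i) (fun c => d c.pt c.inj) (fun c m => ?_)
      fun c k hk => ?_⟩⟩
    · exact hg.hom_ext (by simpa [hi] using hd c.pt c.inj m)
    · refine hd' c.pt c.inj k fun m => ?_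
      simpa [hi] using congrArg (fun k => app (F.map k) g) (hk m)

variable [HasCopowers G]

lemma IsUniversalElement.exists_term [F.IsEquivalence] (hg : IsUniversalElement F g) {M : Type v}
    (w : (F.obj (copower M G)).carrier) :
    ∃ t : V.sig.Term M,
      (t.realize fun m => app (F.map (Sigma.ι (fun _ : M => G) m)) g) = w := by
  obtain ⟨P, ι, hP, ht⟩ := exists_free_object F M
  choose i hi using fun m => hg.exists_hom (ι m)
  obtain ⟨k, hk, -⟩ := hP _ fun m => app (F.map (Sigma.ι (fun _ : M => G) m)) g
  -- The copower is a retract of the free object, so its elements are also values of terms.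
  have h : Sigma.desc i ≫ k = 𝟙 (copower M G) := by
    refine Sigma.hom_ext _ _ fun m => hg.hom_ext ?_
    simp [hi, hk]
  obtain ⟨t, ht⟩ := ht (app (F.map (Sigma.desc i)) w)
  refine ⟨t, ?_⟩
  simp only [← hk]
  rw [← app_realize, ht, ← app_comp, ← F.map_comp, h]
  simp

lemma IsUniversalElement.isAbstractlyFinite [F.IsEquivalence] (hg : IsUniversalElement F g) :
    IsAbstractlyFinite G := by
  classical
  intro M f
  obtain ⟨t, ht⟩ := hg.exists_term (app (F.map f) g)
  let M₀ : Set M := ↑t.varFinset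
  obtain ⟨k, hk⟩ := hg.exists_hom ((t.restrictVar (β := M₀) id).realize
    fun m => app (F.map (Sigma.ι (fun _ : M₀ => G) m)) g)
  refine ⟨M₀, t.varFinset.finite_toSet, k, hg.hom_ext ?_⟩
  rw [F.map_comp, app_comp, hk, app_realize, ← ht]
  refine Term.realize_restrictVar _ fun m => ?_
  rw [← app_comp, ← F.map_comp]
  simp [copowerMap]

/-- The canonical morphism hits every element, and monomorphisms are injective because `G`
represents elements; a mono through which it factors is thus bijective. -/
lemma IsUniversalElement.isStrongGenerator [F.IsEquivalence] (hg : IsUniversalElement F g) :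
    IsStrongGenerator G := by
  intro X
  have hs : Function.Surjective (app (F.map (canonicalMorphism G X))) := by
    intro x
    obtain ⟨f, rfl⟩ := hg.exists_hom x
    refine ⟨app (F.map (Sigma.ι (fun _ : G ⟶ X => G) f)) g, ?_⟩
    rw [← app_comp, ← F.map_comp]
    simp [canonicalMorphism]
  refine { left_cancellation := fun a b hab => F.map_injective ?_, isIso := fun {Z} p i hpi _ => ?_ }
  · refine Variety.Alg.hom_ext fun x => ?_
    obtain ⟨x, rfl⟩ := hs x
    simpa using congrArg (fun k => app (F.map k) x) hab
  · have hi : Function.Injective (app (F.map i)) := by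
      intro a b hab
      obtain ⟨a, rfl⟩ := hg.exists_hom a
      obtain ⟨b, rfl⟩ := hg.exists_hom b
      have : a ≫ i = b ≫ i := hg.hom_ext (by simpa using hab)
      rw [(cancel_mono i).mp this]
    have hi' : Function.Surjective (app (F.map i)) := by
      intro x
      obtain ⟨y, rfl⟩ := hs x
      exact ⟨app (F.map p) y, by rw [← hpi]; simp⟩
    obtain ⟨e, he⟩ := exists_iso_of_bijective _ ⟨hi, hi'⟩
    have : IsIso (F.map i) := he ▸ inferInstance
    exact isIso_of_reflects_iso i F

end OfVariety

end VarietyChar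

namespace VarietyChar

open FirstOrder Language Structure Variety.Alg

/-! ### The variety of hom-algebras of a generator. -/

section HomFunctor

variable {C : Type u} [Category.{v} C] (G : C) [HasCopowers G]

/-- The signature whose `n`-ary operations are the morphisms from `G` to its `n`-th copower. -/
abbrev homSig : FirstOrder.Language.{v, 0} where
  Functions n := G ⟶ copower (ULift.{v} (Fin n)) G
  Relations _ := Empty

noncomputable instance homStructure (X : C) : (homSig G).Structure (G ⟶ X) where
  funMap t x := t ≫ Sigma.desc fun i => x i.down
  RelMap r := r.elim

/-- The variety defined by all the equations which hold in all hom-sets `G ⟶ X`. -/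
def homVariety : Variety.{v} where
  sig := homSig G
  isAlgebraic := fun _ => inferInstanceAs (IsEmpty Empty)
  eqs := { e | ∀ (X : C) (x : ℕ → (G ⟶ X)), e.1.realize x = e.2.realize x }

noncomputable instance homVarietyStructure (X : C) : (homVariety G).sig.Structure (G ⟶ X) :=
  homStructure G X

/-- The functor represented by `G`, with values in algebras. -/
noncomputable def homFunctor : C ⥤ (homVariety G).Alg where
  obj X :=
    { carrier := G ⟶ X
      str := homVarietyStructure G X
      sat := fun _ he x => he X x }
  map f := homMk (fun a => a ≫ f) fun t x => by
    refine (Category.assoc (show G ⟶ copower _ G from t) (Sigma.desc _) f).trans ?_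
    refine congrArg (CategoryStruct.comp (Y := copower _ G) t) ?_
    exact Sigma.hom_ext _ _ fun i => by simp
  map_id X := Variety.Alg.hom_ext fun a => Category.comp_id a
  map_comp f g := Variety.Alg.hom_ext fun a => (Category.assoc a f g).symm

variable {G}

@[simp]
lemma app_homFunctor_map {X Y : C} (f : X ⟶ Y) (a : G ⟶ X) :
    app ((homFunctor G).map f) a = a ≫ f := rfl

/-- The generators of a copower of `G`. -/
noncomputable def gen {M : Type v} (m : M) : G ⟶ copower M G :=
  Sigma.ι (fun _ : M => G) m

/-- Postcomposition is a homomorphism, so the value of a term at the generators determines its value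
in every hom-algebra. -/
lemma realize_comp_desc {M : Type v} {X : C} (t : (homVariety G).sig.Term M) (x : M → (G ⟶ X)) :
    t.realize gen ≫ Sigma.desc x = t.realize x := by
  refine (app_realize ((homFunctor G).map (Sigma.desc x)) t gen).trans ?_
  exact congrArg (fun y : M → (G ⟶ X) => t.realize y) (funext fun m => Sigma.ι_desc _ _)

/-- After numbering the finite set `M₀`, the factorization is itself a basic operation, so one
operation applied to variables suffices. -/
lemma IsAbstractlyFinite.exists_term (hG : IsAbstractlyFinite G) {M : Type v}
    (w : G ⟶ copower M G) : ∃ t : (homVariety G).sig.Term M, t.realize gen = w := by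
  obtain ⟨M₀, hM₀, w, rfl⟩ := hG M w
  have := hM₀.to_subtype
  let e := Finite.equivFin M₀
  refine ⟨Term.func (l := Nat.card M₀) (w ≫ copowerMap (fun m => ULift.up (e m)) G)
    fun i => Term.var (e.symm i), ?_⟩
  change (w ≫ copowerMap _ G) ≫ (Sigma.desc fun i : ULift.{v} (Fin (Nat.card M₀)) =>
    Sigma.ι (fun _ : M => G) (e.symm i.down)) = w ≫ copowerMap _ G
  rw [Category.assoc]
  congr 1
  refine Sigma.hom_ext _ _ fun m => ?_
  simp only [copowerMap, colimit.ι_desc_assoc, Cofan.mk_pt, Cofan.mk_ι_app, colimit.ι_desc]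
  rw [e.symm_apply_apply]

/-- Choose a term for each morphism and evaluate it in `A`. Terms that agree at the generators agree
in all hom-algebras, hence form an equation of the variety, which `A` satisfies. -/
lemma exists_hom_of_copower (hf : IsAbstractlyFinite G) (A : (homVariety G).Alg) :
    ∃ p : (homFunctor G).obj (copower A.carrier G) ⟶ A, ∀ a, app p (gen a) = a := by
  have key : ∀ t t' : (homVariety G).sig.Term A.carrier,
      t.realize (gen (G := G)) = t'.realize gen →
        t.realize id = t'.realize id := by
    intro t t' h
    -- The value of `t` is itself an element, so empty algebras need no separate case.
    have : Nonempty A.carrier := ⟨t.realize id⟩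
    obtain ⟨φ, hφ⟩ := exists_relabel_nat (A := A) t t'
    obtain ⟨y, hy, hy'⟩ := hφ id
    have he : (t.relabel φ, t'.relabel φ) ∈ (homVariety G).eqs := by
      intro X x
      change (t.relabel φ).realize (L := (homVariety G).sig) x =
        (t'.relabel φ).realize (L := (homVariety G).sig) x
      rw [Term.realize_relabel, Term.realize_relabel, ← realize_comp_desc, h, realize_comp_desc]
    rw [← hy, ← hy']
    exact A.sat _ he y
  choose τ hτ using fun w : G ⟶ copower A.carrier G => hf.exists_term w
  have hτ' : ∀ t : (homVariety G).sig.Term A.carrier, (τ (t.realize gen)).realize id =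
      t.realize (M := A.carrier) id := fun t => key _ _ (hτ _)
  refine ⟨homMk (fun w => (τ w).realize id) fun s x => ?_, fun a => hτ' (Term.var a)⟩
  refine Eq.trans ?_ (hτ' (Term.func s fun i => τ (x i)))
  refine congrArg (fun w => (τ w).realize id) ?_
  exact congrArg (funMap s) (funext fun i => (hτ (x i)).symm)

/-! ### The hom functor is an equivalence. -/

lemma IsStrongGenerator.hom_ext (hG : IsStrongGenerator G) {X Y : C} {f f' : X ⟶ Y}
    (h : ∀ a : G ⟶ X, a ≫ f = a ≫ f') : f = f' := by
  have := hG X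
  rw [← cancel_epi (canonicalMorphism G X)]
  exact Sigma.hom_ext _ _ fun a => by simp [canonicalMorphism, h]

lemma IsStrongGenerator.faithful (hG : IsStrongGenerator G) : (homFunctor G).Faithful where
  map_injective {X _ _ _} h := hG.hom_ext fun a => congrArg (fun k => app k (show ((homFunctor G).obj X).carrier from a)) h

/-- `Z` is the coequalizer of the kernel pair of `f`; effectivity makes `q` surjective and `m`
injective on morphisms out of `G`. -/
lemma exists_factorization (hk : HasKernelPairs C) (he : IsEffective G) (hG : IsStrongGenerator G)
    {X Y : C} (f : X ⟶ Y) :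
    ∃ (Z : C) (q : X ⟶ Z) (m : Z ⟶ Y), q ≫ m = f ∧ (∀ u : G ⟶ Z, ∃ v, v ≫ q = u) ∧
      (∀ u v : G ⟶ Z, u ≫ m = v ≫ m → u = v) ∧
      ∀ (W : C) (d : X ⟶ W), (∀ s s' : G ⟶ X, s ≫ f = s' ≫ f → s ≫ d = s' ≫ d) →
        ∃ k : Z ⟶ W, q ≫ k = d := by
  have := hk f
  have hr := IsKernelPair.of_hasPullback f
  obtain ⟨Z, q, w, ⟨hc⟩, hs, hq⟩ := (isEffective_iff G).mp he _ _ (isCongruence_of_isKernelPair hr)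
  have hm : q ≫ Cofork.IsColimit.desc hc f hr.w = f := Cofork.IsColimit.π_desc' hc f hr.w
  refine ⟨Z, q, Cofork.IsColimit.desc hc f hr.w, hm, hs, fun u v huv => ?_, fun W d hd => ?_⟩
  · obtain ⟨u, rfl⟩ := hs u
    obtain ⟨v, rfl⟩ := hs v
    rw [Category.assoc, Category.assoc, hm] at huv
    obtain ⟨t, rfl, rfl⟩ : FactorsThroughPair (pullback.fst f f) (pullback.snd f f) u v :=
      ⟨hr.lift _ _ huv, hr.lift_fst _ _ _, hr.lift_snd _ _ _⟩
    rw [Category.assoc, Category.assoc, w]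
  · have hd' : pullback.fst f f ≫ d = pullback.snd f f ≫ d := hG.hom_ext fun a => by
      rw [← Category.assoc, ← Category.assoc]
      exact hd _ _ (by rw [Category.assoc, Category.assoc, pullback.condition])
    exact ⟨Cofork.IsColimit.desc hc d hd', Cofork.IsColimit.π_desc' hc d hd'⟩

lemma full_homFunctor (hk : HasKernelPairs C) (he : IsEffective G) (hf : IsAbstractlyFinite G)
    (hG : IsStrongGenerator G) : (homFunctor G).Full where
  map_surjective {X Y} h := by
    let d : copower (G ⟶ X) G ⟶ Y := Sigma.desc fun a => app h a
    have hd : ∀ w : G ⟶ copower (G ⟶ X) G, w ≫ d = app h (w ≫ canonicalMorphism G X) := by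
      intro w
      -- Writing `w` as a term reduces the identity to compatibility of `h` with terms.
      obtain ⟨t, rfl⟩ := hf.exists_term w
      refine (realize_comp_desc t _).trans ((app_realize h t _).symm.trans ?_)
      exact congrArg (app h) (realize_comp_desc t fun a => a).symm
    obtain ⟨Z, q, m, hqm, -, hm, hd'⟩ := exists_factorization hk he hG (canonicalMorphism G X)
    have : Mono m := ⟨fun a b hab => hG.hom_ext fun c => hm _ _ (by simp [hab])⟩
    have := hG X
    have := ExtremalEpi.isIso (canonicalMorphism G X) q m hqm
    obtain ⟨k, hk⟩ := hd' Y d fun s s' hs => by rw [hd, hd, hs]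
    refine ⟨inv m ≫ k, Variety.Alg.hom_ext fun a => ?_⟩
    change a ≫ inv m ≫ k = app h a
    have ha : a = Sigma.ι (fun _ : G ⟶ X => G) a ≫ canonicalMorphism G X := by
      simp [canonicalMorphism]
    conv_lhs => rw [ha, ← hqm]
    simp only [Category.assoc, IsIso.hom_inv_id_assoc, hk, d]
    exact Sigma.ι_desc _ _

/-- `B` is realized by the image of the morphism `B·G ⟶ X` induced by `j`: its elements are values
of terms at elements of `B`, hence stay in the subalgebra. -/
lemma essImage_of_injective (hk : HasKernelPairs C) (he : IsEffective G)
    (hf : IsAbstractlyFinite G) (hG : IsStrongGenerator G) {B : (homVariety G).Alg} {X : C}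
    (j : B ⟶ (homFunctor G).obj X) (hj : Function.Injective (app j)) :
    (homFunctor G).essImage B := by
  let d : copower B.carrier G ⟶ X := Sigma.desc fun b => app j b
  obtain ⟨Z, q, m, hqm, hq, hm, -⟩ := exists_factorization hk he hG d
  obtain ⟨g, hg⟩ := exists_lift_of_injective j hj ((homFunctor G).map m) fun u => by
    obtain ⟨v, rfl⟩ := hq u
    obtain ⟨t, ht⟩ := hf.exists_term v
    refine ⟨t.realize id, ?_⟩
    rw [app_homFunctor_map, Category.assoc, hqm, ← ht]
    exact (app_realize j t id).trans (realize_comp_desc t _).symm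
  have hg' : ∀ u : G ⟶ Z, app j (app g u) = u ≫ m := fun u =>
    congrArg (fun k => app k (show ((homFunctor G).obj Z).carrier from u)) hg
  obtain ⟨i, -⟩ := exists_iso_of_bijective g ⟨fun u v huv =>
      hm u v ((hg' u).symm.trans ((congrArg (app j) huv).trans (hg' v))),
    fun b => ⟨Sigma.ι (fun _ : B.carrier => G) b ≫ q, hj ((hg' _).trans (by
        rw [Category.assoc, hqm]
        exact Sigma.ι_desc _ _))⟩⟩
  exact ⟨Z, ⟨i⟩⟩

/-- Fullness lifts the kernel pair of `p` to a congruence in `C`. By effectivity, the hom-algebra of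
its coequalizer and `A` are quotients of the same algebra with the same kernel. -/
lemma essImage_of_kerPair [(homFunctor G).Full] (he : IsEffective G) (hG : IsStrongGenerator G)
    {A : (homVariety G).Alg} {P : C} (p : (homFunctor G).obj P ⟶ A)
    (hp : Function.Surjective (app p)) (h : (homFunctor G).essImage (kerPair p)) :
    (homFunctor G).essImage A := by
  have := hG.faithful
  obtain ⟨R, ⟨i⟩⟩ := h
  let r₀ : R ⟶ P := (homFunctor G).preimage (i.hom ≫ kerFst p)
  let r₁ : R ⟶ P := (homFunctor G).preimage (i.hom ≫ kerSnd p)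
  have hr₀ : ∀ a : G ⟶ R, a ≫ r₀ = app (kerFst p) (app i.hom a) := fun a => by
    rw [← app_homFunctor_map, Functor.map_preimage]
    rfl
  have hr₁ : ∀ a : G ⟶ R, a ≫ r₁ = app (kerSnd p) (app i.hom a) := fun a => by
    rw [← app_homFunctor_map, Functor.map_preimage]
    rfl
  have hi : Function.LeftInverse (app i.inv) (app i.hom) :=
    fun x => by rw [← app_comp]; simp
  have hrel : ∀ {S : C} (s s' : S ⟶ P), FactorsThroughPair r₀ r₁ s s' ↔
      ∀ a : G ⟶ S, app p (a ≫ s) = app p (a ≫ s') := by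
    intro S s s'
    constructor
    · rintro ⟨f, rfl, rfl⟩ a
      rw [← Category.assoc, ← Category.assoc, hr₀, hr₁, kerPair_condition]
    · intro h
      obtain ⟨k, hk₀, hk₁⟩ :=
        exists_kerPair_lift p ((homFunctor G).map s) ((homFunctor G).map s') h
      refine ⟨(homFunctor G).preimage (k ≫ i.inv), (homFunctor G).map_injective ?_,
        (homFunctor G).map_injective ?_⟩
      · simp [r₀, hk₀]
      · simp [r₁, hk₁]
  have hr : IsCongruence r₀ r₁ :=
    { collectively_monic := fun S f f' h₀ h₁ => hG.hom_ext fun a => hi.injective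
        (kerPair_ext p (by rw [← hr₀, ← hr₀, Category.assoc, h₀, Category.assoc])
          (by rw [← hr₁, ← hr₁, Category.assoc, h₁, Category.assoc]))
      refl := (hrel _ _).mpr fun _ => rfl
      symm := (hrel _ _).mpr fun a => ((hrel r₀ r₁).mp ⟨𝟙 R, by simp, by simp⟩ a).symm
      trans := fun S s s' s'' h h' => (hrel _ _).mpr fun a =>
        ((hrel _ _).mp h a).trans ((hrel _ _).mp h' a) }
  obtain ⟨Q, q, w, -, hs, hq⟩ := (isEffective_iff G).mp he r₀ r₁ hr
  have hpq : ∀ s s' : G ⟶ P, s ≫ q = s' ≫ q ↔ app p s = app p s' := by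
    intro s s'
    constructor
    · intro h
      simpa using (hrel s s').mp (hq s s' h) (𝟙 G)
    · intro h
      obtain ⟨x, h₀, h₁⟩ := exists_kerPair p h
      obtain ⟨a, rfl⟩ : ∃ a : G ⟶ R, app i.hom a = x :=
        ⟨app i.inv x, by rw [← app_comp]; simp⟩
      rw [← hr₀] at h₀
      rw [← hr₁] at h₁
      rw [← h₀, ← h₁, Category.assoc, Category.assoc, w]
  obtain ⟨k, hk⟩ := exists_desc_of_surjective ((homFunctor G).map q) hs p
    fun s s' h => (hpq s s').mp h
  have hk' : ∀ s : G ⟶ P, app k (s ≫ q) = app p s := fun s =>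
    congrArg (fun f => app f (show ((homFunctor G).obj P).carrier from s)) hk
  obtain ⟨e, -⟩ := exists_iso_of_bijective k ⟨fun u v huv => by
    obtain ⟨u, rfl⟩ := hs u
    obtain ⟨v, rfl⟩ := hs v
    rw [hk', hk'] at huv
    exact (hpq u v).mpr huv, fun a => by
    obtain ⟨s, rfl⟩ := hp a
    exact ⟨s ≫ q, hk' s⟩⟩
  exact ⟨Q, ⟨e⟩⟩

/-- Elements identified by `p` are identified by `p ≫ h`, which comes from a morphism `f` of `C`;
the kernel pair of `f` thus serves as the ambient object that a product would provide. -/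
lemma essImage_of_hom [(homFunctor G).Full] (hk : HasKernelPairs C) (he : IsEffective G)
    (hf : IsAbstractlyFinite G) (hG : IsStrongGenerator G) {A : (homVariety G).Alg} {X : C}
    (h : A ⟶ (homFunctor G).obj X) : (homFunctor G).essImage A := by
  obtain ⟨p, hp⟩ := exists_hom_of_copower hf A
  refine essImage_of_kerPair he hG p (fun a => ⟨_, hp a⟩) ?_
  let f : copower A.carrier G ⟶ X := (homFunctor G).preimage (p ≫ h)
  have hfp : ∀ u : G ⟶ copower A.carrier G, u ≫ f = app h (app p u) := fun u => by
    rw [← app_homFunctor_map, Functor.map_preimage]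
    rfl
  have := hk f
  have hr := IsKernelPair.of_hasPullback f
  have hz : ∀ x : (kerPair p).carrier, ∃ z : G ⟶ pullback f f,
      z ≫ pullback.fst f f = app (kerFst p) x ∧ z ≫ pullback.snd f f = app (kerSnd p) x := by
    intro x
    have hx : (show G ⟶ copower A.carrier G from app (kerFst p) x) ≫ f =
        (show G ⟶ copower A.carrier G from app (kerSnd p) x) ≫ f := by
      rw [hfp, hfp, kerPair_condition]
    exact ⟨hr.lift _ _ hx, hr.lift_fst _ _ _, hr.lift_snd _ _ _⟩
  choose z hz₀ hz₁ using hz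
  refine essImage_of_injective hk he hf hG (X := pullback f f) (homMk z fun s x => ?_)
    fun x y hxy => ?_
  · refine hr.hom_ext ?_ ?_
    · refine (hz₀ _).trans (Eq.trans ?_
        (app_funMap ((homFunctor G).map (pullback.fst f f)) s fun i => z (x i)).symm)
      rw [app_funMap]
      exact congrArg (funMap s) (funext fun i => (hz₀ _).symm)
    · refine (hz₁ _).trans (Eq.trans ?_
        (app_funMap ((homFunctor G).map (pullback.snd f f)) s fun i => z (x i)).symm)
      rw [app_funMap]
      exact congrArg (funMap s) (funext fun i => (hz₁ _).symm)
  · have hxy' : z x = z y := hxy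
    exact kerPair_ext p (by rw [← hz₀, ← hz₀, hxy']) (by rw [← hz₁, ← hz₁, hxy'])

lemma isEquivalence_homFunctor (hk : HasKernelPairs C) (he : IsEffective G)
    (hf : IsAbstractlyFinite G) (hG : IsStrongGenerator G) : (homFunctor G).IsEquivalence where
  faithful := hG.faithful
  full := full_homFunctor hk he hf hG
  essSurj := ⟨fun A => by
    have := full_homFunctor hk he hf hG
    obtain ⟨p, hp⟩ := exists_hom_of_copower hf A
    -- `A` need not map to a hom-algebra, but the kernel pair of its cover does, through `kerFst p`.
    exact essImage_of_kerPair he hG p (fun a => ⟨_, hp a⟩)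
      (essImage_of_hom hk he hf hG (kerFst p))⟩

end HomFunctor

end VarietyChar

theorem mainTheorem3 (C : Type u) [Category.{v} C] :
    VarietyChar.IsEquivalentToVariety C ↔
      VarietyChar.HasKernelPairs C ∧ VarietyChar.HasCoequalizersOfKernelPairs C ∧
        ∃ (G : C) (_ : VarietyChar.HasCopowers G), VarietyChar.IsEffective G ∧
          VarietyChar.IsAbstractlyFinite G ∧ VarietyChar.IsStrongGenerator G := by
  constructor
  · rintro ⟨V, ⟨e⟩⟩
    obtain ⟨G, g, hg⟩ := VarietyChar.exists_isUniversalElement e.functor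
    have := hg.hasCopowers
    exact ⟨VarietyChar.hasKernelPairs_of_isEquivalence e.functor,
      fun _ _ _ _ r₀ r₁ h =>
        (hg.isEffective r₀ r₁ (VarietyChar.isCongruence_of_isKernelPair h)).1,
      G, this, hg.isEffective, hg.isAbstractlyFinite, hg.isStrongGenerator⟩
  · rintro ⟨hk, -, G, _, he, hf, hG⟩
    have := VarietyChar.isEquivalence_homFunctor hk he hf hG
    exact ⟨VarietyChar.homVariety G, ⟨(VarietyChar.homFunctor G).asEquivalence⟩⟩
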